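/- Fix an exposure range $\mathcal Z\subset\mathbb R$ and a level $z_0\in\mathcal Z$. For each sample size $N$ let there be given, for individuals $i=1,\dots,N$, exposures $Z_i\in\mathcal Z$, covariates $\mathbf X_i\in\mathbb R^d$, potential outcomes $Y_i(z)$, $z\in\mathcal Z$, and observed outcomes $Y_i=Y_i(Z_i)$; let $\eta=\eta_N>0$, $\kappa=\kappa_N\in(0,1)$, and let $\rho$ be a metric on $\mathbb R^d$ (all of these may depend on $N$). Assume that for all large $N$ both windows $[z_0-\eta,z_0-\kappa\eta]$ and $[z_0+\kappa\eta,z_0+\eta]$ contain some $Z_l$, and let $$i_1\in\mathop{\rm argmin}_{l:\,z_0-\eta\le Z_l\le z_0-\kappa\eta}\rho(\mathbf X_l,\mathbf X_i),\qquad i_2\in\mathop{\rm argmin}_{l:\,z_0+\kappa\eta\le Z_l\le z_0+\eta}\rho(\mathbf X_l,\mathbf X_i)$$ (ties broken arbitrarily). Put $\mathcal S=\{(k,l): k\in\{1_1,\dots,N_1\},\ l\in\{1_2,\dots,N_2\}\}$, $$w_{k,l}=\frac1N\sum_{i=1}^N\mathbb I(i_1=k)\,\mathbb I(i_2=l),\qquad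 \delta_{k,l}=\frac{Y_k-Y_l}{Z_k-Z_l}.$$ Keeping the data and the matching fixed, let the exposure assignments $\mathbf Z_{k,l}=(Z^*_k,Z^*_l)_{k,l}$, $(k,l)\in\mathcal S$, be independent random pairs, each equal to $(Z_k,Z_l)$ or to $(Z_l,Z_k)$ with probability $1/2$, and let $$T_N=\sum_{(k,l)\in\mathcal S}w_{k,l}\,\delta^*_{k,l},\qquad \delta^*_{k,l}=\frac{Y_k(a)-Y_l(b)}{a-b}\quad\text{when }\mathbf Z_{k,l}=(a,b).$$ Suppose that there is no local causal effect at $z_0$, that is, $Y_i(z_0+h)=Y_i(z_0)$ for all $i$ and all $|h|\le\eta$ with $z_0+h\in\mathcal Z$. If $\sum_{(k,l)\in\mathcal S}w_{k,l}^2\delta_{k,l}^2>0$ for all large $N$ and $$\frac{\max_{(k,l)\in\mathcal S}w_{k,l}^2\delta_{k,l}^2}{\sum_{(k,l)\in\mathcal S}w_{k,l}^2\delta_{k,l}^2}\longrightarrow0\quad\text{as }N\to\infty,$$ then $$\Big(\sum_{(k,l)\in\mathcal S}w_{k,l}^2\delta_{k,l}^2\Big)^{-1/2}T_N\xrightarrow{d}\mathcal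 N(0,1)\quad\text{as }N\to\infty.$$ -/

import Mathlib

open MeasureTheory ProbabilityTheory Filter Topology

noncomputable section

namespace ACDE

/-- Data on `N` individuals: exposures `Z i` in the exposure range `𝒵`, covariate vectors `X i`,
and potential outcomes `Y i z` (only their values at `z ∈ 𝒵` are meaningful). -/
structure Sample (𝒵 : Set ℝ) (d N : ℕ) where
  Z : Fin N → ℝ
  Z_mem : ∀ i, Z i ∈ 𝒵
  X : Fin N → EuclideanSpace ℝ (Fin d)
  Y : Fin N → ℝ → ℝ

variable {𝒵 : Set ℝ} {d N : ℕ}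

/-- Observed outcome (consistency): `Y_i = Y_i(Z_i)`. -/
def Sample.obs (D : Sample 𝒵 d N) (i : Fin N) : ℝ := D.Y i (D.Z i)

/-- The null hypothesis of no local causal effect at `z₀` within the caliper `η`:
`Y_i(z₀ + h) = Y_i(z₀)` for all individuals `i` and all `|h| ≤ η` with `z₀ + h ∈ 𝒵`. -/
def Sample.NoLocalEffect (D : Sample 𝒵 d N) (z₀ η : ℝ) : Prop :=
  ∀ i, ∀ h : ℝ, |h| ≤ η → z₀ + h ∈ 𝒵 → D.Y i z₀ = D.Y i (z₀ + h)

/-- `j` is a nearest neighbour of `i`, for the covariate metric `ρ`, among the individuals whose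
exposure lies in the window `W`. -/
def Sample.IsNearestIn (D : Sample 𝒵 d N) (ρ : MetricSpace (EuclideanSpace ℝ (Fin d)))
    (W : Set ℝ) (i j : Fin N) : Prop :=
  D.Z j ∈ W ∧ ∀ l, D.Z l ∈ W → ρ.dist (D.X j) (D.X i) ≤ ρ.dist (D.X l) (D.X i)

/-- The maps `i ↦ i₁` (`left`) and `i ↦ i₂` (`right`). -/
structure Matching (N : ℕ) where
  left : Fin N → Fin N
  right : Fin N → Fin N

/-- The matching is the result of nearest neighbour matching with replacement on the windows
`[z₀ - η, z₀ - κη]` and `[z₀ + κη, z₀ + η]` (ties are broken arbitrarily). -/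
def Matching.IsNearest (M : Matching N) (D : Sample 𝒵 d N)
    (ρ : MetricSpace (EuclideanSpace ℝ (Fin d))) (z₀ η κ : ℝ) : Prop :=
  ∀ i, D.IsNearestIn ρ (Set.Icc (z₀ - η) (z₀ - κ * η)) i (M.left i) ∧
    D.IsNearestIn ρ (Set.Icc (z₀ + κ * η) (z₀ + η)) i (M.right i)

/-- The set `𝒮 = 𝒮₁ × 𝒮₂` of combinations of a left match and a right match. -/
def Matching.combos (M : Matching N) : Finset (Fin N × Fin N) :=
  Finset.univ.image M.left ×ˢ Finset.univ.image M.right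

/-- The weight `w_{k,l} = (1/N) ∑ i, 𝕀(i₁ = k) 𝕀(i₂ = l)`. -/
def Matching.weight (M : Matching N) (p : Fin N × Fin N) : ℝ :=
  (1 / (N : ℝ)) * ∑ i, (if M.left i = p.1 then 1 else 0) * (if M.right i = p.2 then 1 else 0)

/-- The observed average rate of change `δ_{k,l} = (Y_k - Y_l) / (Z_k - Z_l)`. -/
def Sample.rate (D : Sample 𝒵 d N) (p : Fin N × Fin N) : ℝ :=
  (D.obs p.1 - D.obs p.2) / (D.Z p.1 - D.Z p.2)

/-- The average rate of change of the combination `(k, l)` that is observed when `k` receives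
exposure `a.1` and `l` receives exposure `a.2`. -/
def Sample.rateUnder (D : Sample 𝒵 d N) (p : Fin N × Fin N) (a : ℝ × ℝ) : ℝ :=
  (D.Y p.1 a.1 - D.Y p.2 a.2) / (a.1 - a.2)

/-- The law of the exposure assignment `𝐙_{k,l}` without hidden confounding: it takes each of the
two values `(Z_k, Z_l)` and `(Z_l, Z_k)` with probability `1/2`. -/
def Sample.assignmentLaw (D : Sample 𝒵 d N) (p : Fin N × Fin N) : Measure (ℝ × ℝ) :=
  (2⁻¹ : ENNReal) • Measure.dirac (D.Z p.1, D.Z p.2) +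
    (2⁻¹ : ENNReal) • Measure.dirac (D.Z p.2, D.Z p.1)

/-- The statistic `T_N = ∑_{(k,l) ∈ 𝒮} w_{k,l} δ_{k,l}`, where the rates of change are those
observed when each combination `p` receives the pair of exposures `a p`; the matching, and hence
the weights, are kept. At `a (k, l) = (Z_k, Z_l)` it is the matching estimator. -/
def testStatistic (D : Sample 𝒵 d N) (M : Matching N) (a : Fin N × Fin N → ℝ × ℝ) : ℝ :=
  ∑ p ∈ M.combos, M.weight p * D.rateUnder p (a p)

/-- The normalising sum `∑_{(k,l) ∈ 𝒮} w_{k,l}² δ_{k,l}²`. -/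
def sumSq (D : Sample 𝒵 d N) (M : Matching N) : ℝ :=
  ∑ p ∈ M.combos, M.weight p ^ 2 * D.rate p ^ 2

/-- The maximum of `w_{k,l}² δ_{k,l}²` over the finite set `𝒮`. -/
def maxSq (D : Sample 𝒵 d N) (M : Matching N) : ℝ :=
  ⨆ p : M.combos, M.weight p.1 ^ 2 * D.rate p.1 ^ 2

end ACDE

end

/-! Without a local effect, an exchange of two exposures keeps the numerator of a rate and negates
its denominator. With the matching fixed, `testStatistic` is therefore a sum of independent random
signs with coefficients `w δ`, and its characteristic function is a product of cosines
(`charFun_map_testStatistic`). After normalisation the squared arguments sum to `t ^ 2`. Replacing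
each `cos x` by `exp (-x ^ 2 / 2)` costs at most `x ^ 4`, so the total error is at most the largest
square times `t ^ 2`, which vanishes by the max-to-sum condition (`tendsto_prod_cos`). Lévy's
continuity theorem concludes. -/

/-- Finite products of numbers in `[-1, 1]` differ by at most the sum of the differences. -/
lemma abs_prod_sub_prod_le_sum {ι : Type*} (s : Finset ι) (a b : ι → ℝ)
    (ha : ∀ i ∈ s, |a i| ≤ 1) (hb : ∀ i ∈ s, |b i| ≤ 1) :
    |∏ i ∈ s, a i - ∏ i ∈ s, b i| ≤ ∑ i ∈ s, |a i - b i| := by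
  classical
  induction s using Finset.induction_on with
  | empty => simp
  | insert j s hj ih =>
    have ha' : ∀ i ∈ s, |a i| ≤ 1 := fun i hi => ha i (Finset.mem_insert_of_mem hi)
    have hb' : ∀ i ∈ s, |b i| ≤ 1 := fun i hi => hb i (Finset.mem_insert_of_mem hi)
    rw [Finset.prod_insert hj, Finset.prod_insert hj, Finset.sum_insert hj]
    have hprod : |∏ i ∈ s, a i| ≤ 1 := by
      rw [Finset.abs_prod]
      exact Finset.prod_le_one (fun i _ => abs_nonneg _) ha'
    -- Telescoping: one factor is exchanged at a time.
    calc |a j * ∏ i ∈ s, a i - b j * ∏ i ∈ s, b i|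
        = |(a j - b j) * ∏ i ∈ s, a i + b j * (∏ i ∈ s, a i - ∏ i ∈ s, b i)| := by ring_nf
      _ ≤ |a j - b j| * |∏ i ∈ s, a i| + |b j| * |∏ i ∈ s, a i - ∏ i ∈ s, b i| := by
          rw [← abs_mul, ← abs_mul]
          exact abs_add_le _ _
      _ ≤ |a j - b j| * 1 + 1 * ∑ i ∈ s, |a i - b i| := by
          gcongr
          · exact hb j (Finset.mem_insert_self _ _)
          · exact ih ha' hb'
      _ = _ := by ring

/-- Both functions equal `1 - x ^ 2 / 2` up to a small multiple of `x ^ 4`. -/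
lemma abs_cos_sub_exp_neg_sq_div_two_le {x : ℝ} (hx : |x| ≤ 1) :
    |Real.cos x - Real.exp (-x ^ 2 / 2)| ≤ x ^ 4 := by
  have hx2 : x ^ 2 ≤ 1 := (sq_le_one_iff_abs_le_one x).2 hx
  have h1 := Real.cos_bound hx
  have h2 : |Real.exp (-x ^ 2 / 2) - 1 - (-x ^ 2 / 2)| ≤ (-x ^ 2 / 2) ^ 2 :=
    Real.abs_exp_sub_one_sub_id_le (by
      rw [abs_le]
      constructor <;> nlinarith [sq_nonneg x])
  have h4 : |x| ^ 4 = x ^ 4 := by rw [← abs_pow, abs_of_nonneg (by positivity)]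
  rw [h4, abs_le] at h1
  rw [abs_le] at h2 ⊢
  have h0 : 0 ≤ x ^ 4 := by positivity
  constructor <;> nlinarith [h1.1, h1.2, h2.1, h2.2]

/-- The exponential factorises over `s`, so the factors can be compared one by one, with `x ^ 4 ≤ m
* x ^ 2`. -/
lemma abs_prod_cos_sub_exp_le {ι : Type*} (s : Finset ι) (x : ι → ℝ) {m : ℝ} (hm : m ≤ 1)
    (hx : ∀ i ∈ s, x i ^ 2 ≤ m) :
    |∏ i ∈ s, Real.cos (x i) - Real.exp (-(∑ i ∈ s, x i ^ 2) / 2)| ≤ m * ∑ i ∈ s, x i ^ 2 := by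
  have hexp : Real.exp (-(∑ i ∈ s, x i ^ 2) / 2) = ∏ i ∈ s, Real.exp (-x i ^ 2 / 2) := by
    rw [← Real.exp_sum, ← Finset.sum_neg_distrib, Finset.sum_div]
  rw [hexp, Finset.mul_sum]
  refine (abs_prod_sub_prod_le_sum s _ _ (fun i _ => Real.abs_cos_le_one _) fun i _ => ?_).trans
    (Finset.sum_le_sum fun i hi => ?_)
  · rw [Real.abs_exp, Real.exp_le_one_iff]
    nlinarith [sq_nonneg (x i)]
  · calc _ ≤ x i ^ 4 := abs_cos_sub_exp_neg_sq_div_two_le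
          ((sq_le_one_iff_abs_le_one _).1 ((hx i hi).trans hm))
      _ = x i ^ 2 * x i ^ 2 := by ring
      _ ≤ m * x i ^ 2 := by
          gcongr
          exact hx i hi

/-- If the squares `x n i ^ 2` sum to `v` and are uniformly small, then `∏ cos (x n i)` tends to
the Gaussian characteristic function value `exp (-v / 2)`. -/
lemma tendsto_prod_cos {ι : ℕ → Type*} (s : (n : ℕ) → Finset (ι n)) (x : (n : ℕ) → ι n → ℝ)
    {v : ℝ} {m : ℕ → ℝ} (hm : Tendsto m atTop (𝓝 0))
    (hsum : ∀ᶠ n in atTop, ∑ i ∈ s n, x n i ^ 2 = v)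
    (hx : ∀ᶠ n in atTop, ∀ i ∈ s n, x n i ^ 2 ≤ m n) :
    Tendsto (fun n => ∏ i ∈ s n, Real.cos (x n i)) atTop (𝓝 (Real.exp (-v / 2))) := by
  rw [tendsto_iff_dist_tendsto_zero]
  have hlim : Tendsto (fun n => m n * v) atTop (𝓝 0) := by simpa using hm.mul_const v
  refine squeeze_zero' (.of_forall fun _ => dist_nonneg) ?_ hlim
  filter_upwards [hsum, hx, hm.eventually_le_const zero_lt_one] with n h1 h2 h3
  have h := abs_prod_cos_sub_exp_le (s n) (x n) h3 h2
  rwa [h1] at h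

/-- The characteristic function of a uniformly random sign change of `r`. -/
lemma charFun_half_dirac_add_half_dirac_neg (r t : ℝ) :
    charFun ((2⁻¹ : ENNReal) • Measure.dirac r + (2⁻¹ : ENNReal) • Measure.dirac (-r)) t =
      (Real.cos (t * r) : ℂ) := by
  have hi (a : ℝ) : Integrable (fun x : ℝ => Complex.exp (t * x * Complex.I))
      ((2⁻¹ : ENNReal) • Measure.dirac a) :=
    (integrable_dirac (by simp)).smul_measure (by simp)
  rw [charFun_apply_real, integral_add_measure (hi _) (hi _), integral_smul_measure,
    integral_smul_measure, integral_dirac, integral_dirac, Complex.ofReal_cos, Complex.cos]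
  simp
  ring_nf

namespace ACDE

variable {𝒵 : Set ℝ} {d N : ℕ}

/-- The law has at most two atoms, so `f` is arbitrary; potential outcomes need not be measurable in
the exposure. -/
lemma aemeasurable_assignmentLaw {β : Type*} [MeasurableSpace β] (D : Sample 𝒵 d N)
    (p : Fin N × Fin N) (f : ℝ × ℝ → β) : AEMeasurable f (D.assignmentLaw p) :=
  (aemeasurable_dirac.smul_measure _).add_measure (aemeasurable_dirac.smul_measure _)

lemma map_assignmentLaw {β : Type*} [MeasurableSpace β] (D : Sample 𝒵 d N)
    (p : Fin N × Fin N) (f : ℝ × ℝ → β) :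
    (D.assignmentLaw p).map f =
      (2⁻¹ : ENNReal) • Measure.dirac (f (D.Z p.1, D.Z p.2)) +
        (2⁻¹ : ENNReal) • Measure.dirac (f (D.Z p.2, D.Z p.1)) := by
  ext s hs
  rw [Measure.map_apply_of_aemeasurable (aemeasurable_assignmentLaw D p f) hs]
  simp [Sample.assignmentLaw, hs, Set.indicator]
  rfl

/-- Both exposures of a combination lie within the caliper around `z₀`. -/
lemma Matching.IsNearest.abs_sub_le {M : Matching N} {D : Sample 𝒵 d N}
    {ρ : MetricSpace (EuclideanSpace ℝ (Fin d))} {z₀ η κ : ℝ} (hM : M.IsNearest D ρ z₀ η κ)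
    (hη : 0 < η) (hκ : 0 < κ) {p : Fin N × Fin N} (hp : p ∈ M.combos) :
    |D.Z p.1 - z₀| ≤ η ∧ |D.Z p.2 - z₀| ≤ η := by
  obtain ⟨h₁, h₂⟩ := Finset.mem_product.1 hp
  obtain ⟨i, -, hi⟩ := Finset.mem_image.1 h₁
  obtain ⟨j, -, hj⟩ := Finset.mem_image.1 h₂
  have hl := (hM i).1.1
  have hr := (hM j).2.1
  rw [hi] at hl
  rw [hj] at hr
  have := mul_pos hκ hη
  constructor <;> rw [abs_le] <;> constructor <;> linarith [hl.1, hl.2, hr.1, hr.2]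

lemma Sample.NoLocalEffect.apply_eq {D : Sample 𝒵 d N} {z₀ η : ℝ} (h : D.NoLocalEffect z₀ η)
    (i : Fin N) {z : ℝ} (hz : z ∈ 𝒵) (hd : |z - z₀| ≤ η) : D.Y i z = D.Y i z₀ := by
  have := h i (z - z₀) hd (by simpa using hz)
  simpa using this.symm

lemma Sample.rateUnder_obs (D : Sample 𝒵 d N) (p : Fin N × Fin N) :
    D.rateUnder p (D.Z p.1, D.Z p.2) = D.rate p := rfl

/-- Without a local effect, exchanging the exposures of a combination changes the sign of its
rate of change. -/
lemma Sample.NoLocalEffect.rateUnder_swap {D : Sample 𝒵 d N} {z₀ η : ℝ}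
    (h : D.NoLocalEffect z₀ η) {p : Fin N × Fin N} (h₁ : |D.Z p.1 - z₀| ≤ η)
    (h₂ : |D.Z p.2 - z₀| ≤ η) : D.rateUnder p (D.Z p.2, D.Z p.1) = -D.rate p := by
  simp only [Sample.rateUnder, Sample.rate, Sample.obs]
  -- Each exposure occurs with both individuals, hence two rewrites apiece; every outcome becomes
  -- its value at `z₀`.
  rw [h.apply_eq _ (D.Z_mem _) h₁, h.apply_eq _ (D.Z_mem _) h₁, h.apply_eq _ (D.Z_mem _) h₂,
    h.apply_eq _ (D.Z_mem _) h₂, ← neg_sub (D.Z p.1), div_neg]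

section Randomization

variable {Ω : Type*} [MeasurableSpace Ω] {P : Measure Ω} {D : Sample 𝒵 d N} {M : Matching N}
  {A : Fin N × Fin N → Ω → ℝ × ℝ}

lemma aemeasurable_comp_assignment {β : Type*} [MeasurableSpace β] {p : Fin N × Fin N}
    (hlaw : HasLaw (A p) (D.assignmentLaw p) P) (f : ℝ × ℝ → β) :
    AEMeasurable (fun ω => f (A p ω)) P := by
  refine AEMeasurable.comp_aemeasurable (g := f) ?_ hlaw.aemeasurable
  rw [hlaw.map_eq]
  exact aemeasurable_assignmentLaw D p f

lemma aemeasurable_testStatistic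
    (hlaw : ∀ p ∈ M.combos, HasLaw (A p) (D.assignmentLaw p) P) :
    AEMeasurable (fun ω => testStatistic D M (fun p => A p ω)) P :=
  Finset.aemeasurable_fun_sum _ fun p hp =>
    (aemeasurable_comp_assignment (hlaw p hp) (D.rateUnder p)).const_mul _

lemma charFun_map_weight_mul_rateUnder {z₀ η : ℝ} (hnull : D.NoLocalEffect z₀ η)
    {p : Fin N × Fin N} (hlaw : HasLaw (A p) (D.assignmentLaw p) P)
    (h₁ : |D.Z p.1 - z₀| ≤ η) (h₂ : |D.Z p.2 - z₀| ≤ η) (t : ℝ) :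
    charFun (P.map fun ω => M.weight p * D.rateUnder p (A p ω)) t =
      (Real.cos (t * (M.weight p * D.rate p)) : ℂ) := by
  have hmap : P.map (fun ω => M.weight p * D.rateUnder p (A p ω)) =
      (D.assignmentLaw p).map fun a => M.weight p * D.rateUnder p a := by
    rw [← hlaw.map_eq, AEMeasurable.map_map_of_aemeasurable _ hlaw.aemeasurable]
    · rfl
    · rw [hlaw.map_eq]
      exact aemeasurable_assignmentLaw D p _
  rw [hmap, map_assignmentLaw, D.rateUnder_obs, hnull.rateUnder_swap h₁ h₂, mul_neg,
    charFun_half_dirac_add_half_dirac_neg]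

/-- The characteristic function of the test statistic under the randomization distribution. -/
lemma charFun_map_testStatistic {z₀ η : ℝ} (hnull : D.NoLocalEffect z₀ η)
    (hcal : ∀ p ∈ M.combos, |D.Z p.1 - z₀| ≤ η ∧ |D.Z p.2 - z₀| ≤ η)
    (hlaw : ∀ p ∈ M.combos, HasLaw (A p) (D.assignmentLaw p) P)
    (hindep : iIndepFun (fun p : M.combos => A p.1) P) (t : ℝ) :
    charFun (P.map fun ω => testStatistic D M (fun p => A p ω)) t =
      ((∏ p ∈ M.combos, Real.cos (t * (M.weight p * D.rate p)) : ℝ) : ℂ) := by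
  have hind : iIndepFun
      (M.combos.restrict fun p ω => M.weight p * D.rateUnder p (A p ω)) P :=
    hindep.comp₀ (fun p a => M.weight p.1 * D.rateUnder p.1 a)
      (fun p => (hlaw p.1 p.2).aemeasurable) fun p => by
        rw [(hlaw p.1 p.2).map_eq]
        exact aemeasurable_assignmentLaw D p.1 _
  have hsum := hind.charFun_map_fun_finsetSum_eq_prod fun p hp =>
    aemeasurable_comp_assignment (hlaw p hp) fun a => M.weight p * D.rateUnder p a
  simp only [testStatistic]
  rw [hsum, Finset.prod_apply, Complex.ofReal_prod]
  exact Finset.prod_congr rfl fun p hp =>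
    charFun_map_weight_mul_rateUnder hnull (hlaw p hp) (hcal p hp).1 (hcal p hp).2 t

end Randomization

/-- Finiteness of the index set bounds the family, without which a real `⨆` need not be an upper
bound. -/
lemma le_maxSq (D : Sample 𝒵 d N) (M : Matching N) {p : Fin N × Fin N} (hp : p ∈ M.combos) :
    M.weight p ^ 2 * D.rate p ^ 2 ≤ maxSq D M :=
  le_ciSup (f := fun p : M.combos => M.weight p.1 ^ 2 * D.rate p.1 ^ 2)
    (Set.finite_range _).bddAbove ⟨p, hp⟩

end ACDE

theorem theorem2 {𝒵 : Set ℝ} {d : ℕ} (z₀ : ℝ) (hz₀ : z₀ ∈ 𝒵)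
    (η κ : ℕ → ℝ) (hη : ∀ N, 0 < η N) (hκ : ∀ N, κ N ∈ Set.Ioo (0 : ℝ) 1)
    (ρ : ℕ → MetricSpace (EuclideanSpace ℝ (Fin d)))
    (D : (N : ℕ) → ACDE.Sample 𝒵 d N) (M : (N : ℕ) → ACDE.Matching N)
    (hM : ∀ᶠ N in atTop, (M N).IsNearest (D N) (ρ N) z₀ (η N) (κ N))
    (hnull : ∀ N, (D N).NoLocalEffect z₀ (η N))
    {Ω : ℕ → Type*} [∀ N, MeasurableSpace (Ω N)]
    (P : (N : ℕ) → Measure (Ω N)) [∀ N, IsProbabilityMeasure (P N)]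
    (A : (N : ℕ) → Fin N × Fin N → Ω N → ℝ × ℝ)
    (hlaw : ∀ N, ∀ p ∈ (M N).combos, HasLaw (A N p) ((D N).assignmentLaw p) (P N))
    (hindep : ∀ N, iIndepFun (fun p : (M N).combos => A N p.1) (P N))
    (hpos : ∀ᶠ N in atTop, 0 < ACDE.sumSq (D N) (M N))
    (hmax : Tendsto (fun N => ACDE.maxSq (D N) (M N) / ACDE.sumSq (D N) (M N)) atTop (𝓝 0)) :
    TendstoInDistribution
      (fun N ω => (√(ACDE.sumSq (D N) (M N)))⁻¹ *
        ACDE.testStatistic (D N) (M N) (fun p => A N p ω))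
      atTop (id : ℝ → ℝ) P (gaussianReal 0 1) := by
  refine ⟨fun N => (ACDE.aemeasurable_testStatistic (hlaw N)).const_mul _, by fun_prop, ?_⟩
  refine ProbabilityMeasure.tendsto_iff_tendsto_charFun.2 fun t => ?_
  simp only [ProbabilityMeasure.coe_mk, Measure.map_id, charFun_gaussianReal]
  have hcos : Tendsto (fun N => ∏ p ∈ (M N).combos, Real.cos
      ((√(ACDE.sumSq (D N) (M N)))⁻¹ * t * ((M N).weight p * (D N).rate p))) atTop
      (𝓝 (Real.exp (-t ^ 2 / 2))) := by
    refine tendsto_prod_cos (v := t ^ 2)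
      (m := fun N => ACDE.maxSq (D N) (M N) / ACDE.sumSq (D N) (M N) * t ^ 2) _ _
      (by simpa using hmax.mul_const (t ^ 2)) ?_ ?_
    · filter_upwards [hpos] with N hN
      simp only [mul_pow, ← Finset.mul_sum, inv_pow, Real.sq_sqrt hN.le]
      change (ACDE.sumSq (D N) (M N))⁻¹ * t ^ 2 * ACDE.sumSq (D N) (M N) = t ^ 2
      field_simp
    · filter_upwards [hpos] with N hN p hp
      simp only [mul_pow, inv_pow, Real.sq_sqrt hN.le]
      calc _ ≤ (ACDE.sumSq (D N) (M N))⁻¹ * t ^ 2 * ACDE.maxSq (D N) (M N) := by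
            gcongr
            exact ACDE.le_maxSq _ _ hp
        _ = _ := by ring
  have hlim : Complex.exp (t * (0 : ℝ) * Complex.I - (1 : NNReal) * t ^ 2 / 2) =
      ((Real.exp (-t ^ 2 / 2) : ℝ) : ℂ) := by
    push_cast
    congr 1
    ring
  rw [hlim]
  refine ((Complex.continuous_ofReal.tendsto _).comp hcos).congr' ?_
  filter_upwards [hM] with N hN
  -- The normalising factor moves into the argument of the characteristic function.
  rw [charFun_map_mul_comp (ACDE.aemeasurable_testStatistic (hlaw N))]
  exact (ACDE.charFun_map_testStatistic (hnull N)
    (fun p hp => hN.abs_sub_le (hη N) (hκ N).1 hp) (hlaw N) (hindep N) _).symm
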